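/- Let $d\ge 1$ and let $\mathbf X$ be a random vector in $\mathbb R^d$ with finite second moments, mean $\boldsymbol\mu$ and full-rank (positive definite) covariance matrix $\boldsymbol\Sigma$, and suppose that $\mathbf X$ is elliptical, i.e. its characteristic function has the form $\mathbb E\,e^{i\mathbf t'\mathbf X}=e^{i\mathbf t'\boldsymbol\mu}\,\phi(\mathbf t'\boldsymbol\Sigma\mathbf t)$, $\mathbf t\in\mathbb R^d$, for some scalar function $\phi$. Let $\lambda_1\ge\cdots\ge\lambda_d$ be the eigenvalues of $\boldsymbol\Sigma$, with corresponding orthonormal eigenvectors $v_1,\dots,v_d$, let $\mathbf V=(v_1,\dots,v_d)$ be the matrix with these columns, and let $\mathbf Y=(Y_1,\dots,Y_d)'=\mathbf V'\mathbf X$. For $\alpha\in[0,1]$ let $$\mathsf T_{Y_i}^\alpha=\bigl[\,Q_{Y_i}(\alpha/2),\,Q_{Y_i}(1-\alpha/2)\,\bigr],\qquad Q_{Y_i}(p)=\inf\{x\in\mathbb R:\ \mathbb P(Y_i\le x)\ge p\}\in[-\infty,\infty],$$ be the central $(1-\alpha)$-inter-quantile interval of $Y_i$ (as a set of real numbers),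 and let $$\tau_i=\operatorname{Tr}\Bigl(\operatorname{Cov}\bigl(\mathbf Y\,\big|\,Y_i\in\mathsf T_{Y_i}^\alpha\bigr)\Bigr)$$ be the preserved total variance after truncating only the coordinate $Y_i$. Then $\mathbb P(Y_i\in\mathsf T_{Y_i}^\alpha)\ge 1-\alpha$ for every $i$, so that $\tau_i$ is well defined whenever $\alpha<1$ (if $\alpha=1$ and the conditioning event is null, $\tau_i$ is taken to be $0$), and: 1. the preserved total variance is nonincreasing in the eigenvalue: for all $i,j$, if $\lambda_i\le\lambda_j$ then $\tau_j\le\tau_i$; 2. consequently, for every $i$, $\tau_1\le\tau_i\le\tau_d$; that is, it is maximized by peeling $Y_d$ and minimized by peeling $Y_1$. -/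

import Mathlib

open MeasureTheory ProbabilityTheory
open scoped Matrix

noncomputable section

namespace Peeling

/-- The covariance matrix `(Cov(Z_i, Z_j))_{i,j}` of a random vector `Z` under the measure `P`. -/
def covMatrix {Ω : Type*} [MeasurableSpace Ω] {d : ℕ}
    (Z : Ω → EuclideanSpace ℝ (Fin d)) (P : Measure Ω) : Matrix (Fin d) (Fin d) ℝ :=
  Matrix.of fun i j => cov[fun ω => Z ω i, fun ω => Z ω j; P]

/-- `X` is an elliptical random vector with mean `m` and full-rank covariance matrix `S`:
its characteristic function is `t ↦ exp(i ⟨t, m⟩) φ(tᵀ S t)` for some scalar function `φ`. -/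
structure IsElliptical {Ω : Type*} [MeasurableSpace Ω] {d : ℕ}
    (X : Ω → EuclideanSpace ℝ (Fin d)) (P : Measure Ω)
    (m : EuclideanSpace ℝ (Fin d)) (S : Matrix (Fin d) (Fin d) ℝ) : Prop where
  measurable : Measurable X
  memLp : MemLp X 2 P
  mean_eq : ∫ ω, X ω ∂P = m
  cov_eq : covMatrix X P = S
  posDef : S.PosDef
  charFun_eq : ∃ φ : ℝ → ℂ, ∀ t : EuclideanSpace ℝ (Fin d),
    charFun (P.map X) t
      = Complex.exp (Complex.I * ((inner ℝ t m : ℝ) : ℂ)) * φ (t.ofLp ⬝ᵥ (S *ᵥ t.ofLp))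

/-- The `p`-quantile `inf {x : ℝ | p ≤ F(x)}` of a law on the line with distribution function `F`.
It is extended-real-valued, so that the `0`-quantile is `-∞` and the `1`-quantile may be `+∞`. -/
def quantile (ν : Measure ℝ) (p : ℝ) : EReal :=
  sInf ((fun x : ℝ => (x : EReal)) '' {x : ℝ | p ≤ cdf ν x})

/-- The central `(1 - α)`-inter-quantile interval `[Q(α/2), Q(1 - α/2)]`, as a set of reals. -/
def centralInterval (ν : Measure ℝ) (α : ℝ) : Set ℝ :=
  {y : ℝ | quantile ν (α / 2) ≤ (y : EReal) ∧ (y : EReal) ≤ quantile ν (1 - α / 2)}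

/-- The matrix `V = (v₁, …, v_d)` with columns `v_j`. -/
def columnMatrix {d : ℕ} (v : Fin d → EuclideanSpace ℝ (Fin d)) : Matrix (Fin d) (Fin d) ℝ :=
  Matrix.of fun i j => v j i

/-- The rotated vector `Y = Vᵀ X`. -/
def rotate {Ω : Type*} {d : ℕ} (v : Fin d → EuclideanSpace ℝ (Fin d))
    (X : Ω → EuclideanSpace ℝ (Fin d)) : Ω → EuclideanSpace ℝ (Fin d) :=
  fun ω => WithLp.toLp 2 ((columnMatrix v)ᵀ *ᵥ (X ω).ofLp)

/-- The event that the `i`-th coordinate of `Y` lies in its central `(1 - α)`-inter-quantile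
interval. -/
def peelEvent {Ω : Type*} [MeasurableSpace Ω] {d : ℕ}
    (Y : Ω → EuclideanSpace ℝ (Fin d)) (P : Measure Ω) (α : ℝ) (i : Fin d) : Set Ω :=
  {ω | Y ω i ∈ centralInterval (P.map fun ω' => Y ω' i) α}

/-- The preserved total variance: the trace of the covariance matrix of `Y` conditional on the
event that `Y_i` lies in its central `(1 - α)`-inter-quantile interval. -/
def preservedTotalVariance {Ω : Type*} [MeasurableSpace Ω] {d : ℕ}
    (Y : Ω → EuclideanSpace ℝ (Fin d)) (P : Measure Ω) (α : ℝ) (i : Fin d) : ℝ :=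
  (covMatrix Y (P[|peelEvent Y P α i])).trace

end Peeling

end

namespace Peeling

/-! The vector `Z = Λ^(-1/2) Vᵀ (X - m)` is spherical, and each `Y_k` is an increasing affine
function of `Z_k` with slope `√(lam k)`. All `Z_k` have one symmetric law; let `T` be its central
interval. Peeling `Y_i` means conditioning on `Z_i ∈ T`, so `τ_i = ∑ lam k * Var(Z_k | Z_i ∈ T)`.
Exchanging coordinates `i` and `j` turns the variances behind `τ_j` into those behind `τ_i` with two
entries swapped, hence `τ_i - τ_j = (lam j - lam i) * (Var(Z_j | Z_i ∈ T) - Var(Z_i | Z_i ∈ T))`.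
The last factor is nonnegative (`IsSpherical.variance_cond_le`): restricting `Z_i` to an interval
around 0 shrinks it at least as much as the other coordinates. This rests on
`IsSpherical.setIntegral_sq_le`, proved by symmetrizing under a sign flip and a swap. -/

/-! ### Quantiles and central intervals -/

theorem quantile_le_coe_iff (ν : Measure ℝ) (p y : ℝ) :
    quantile ν p ≤ (y : EReal) ↔ p ≤ cdf ν y := by
  constructor
  · intro h
    have key : ∀ z ∈ Set.Ioi y, p ≤ cdf ν z := by
      intro z hz
      have h1 : quantile ν p < (z : EReal) := lt_of_le_of_lt h (EReal.coe_lt_coe_iff.2 hz)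
      obtain ⟨_, ⟨x, hx, rfl⟩, hxz⟩ := sInf_lt_iff.1 h1
      exact le_trans hx (monotone_cdf ν (EReal.coe_lt_coe_iff.1 hxz).le)
    -- Right continuity of the distribution function carries the bound from `z > y` down to `y`.
    have hcont : ContinuousWithinAt (cdf ν) (Set.Ioi y) y :=
      ((cdf ν).right_continuous y).mono Set.Ioi_subset_Ici_self
    exact ge_of_tendsto hcont (Filter.eventually_of_mem self_mem_nhdsWithin key)
  · intro h
    exact sInf_le ⟨y, h, rfl⟩

theorem coe_le_quantile_iff (ν : Measure ℝ) (p y : ℝ) :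
    (y : EReal) ≤ quantile ν p ↔ ∀ x < y, cdf ν x < p := by
  unfold quantile
  rw [le_sInf_iff]
  constructor
  · intro h x hx
    by_contra! hp
    exact absurd (EReal.coe_le_coe_iff.1 (h _ ⟨x, hp, rfl⟩)) (not_le.2 hx)
  · rintro h _ ⟨x, hx, rfl⟩
    by_contra! hlt
    exact absurd (h x (EReal.coe_lt_coe_iff.1 hlt)) (not_lt.2 hx)

theorem mem_centralInterval_iff {ν : Measure ℝ} {α y : ℝ} :
    y ∈ centralInterval ν α ↔ α / 2 ≤ cdf ν y ∧ ∀ x < y, cdf ν x < 1 - α / 2 :=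
  and_congr (quantile_le_coe_iff ν _ y) (coe_le_quantile_iff ν _ y)

theorem ordConnected_centralInterval (ν : Measure ℝ) (α : ℝ) :
    (centralInterval ν α).OrdConnected := by
  refine ⟨fun x hx y hy z hz => ?_⟩
  rw [mem_centralInterval_iff] at *
  exact ⟨hx.1.trans (monotone_cdf ν hz.1), fun w hw => hy.2 w (hw.trans_le hz.2)⟩

theorem measurableSet_centralInterval (ν : Measure ℝ) (α : ℝ) :
    MeasurableSet (centralInterval ν α) :=
  (ordConnected_centralInterval ν α).measurableSet

theorem subsingleton_centralInterval_one (ν : Measure ℝ) :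
    (centralInterval ν 1).Subsingleton := by
  have key : ∀ x ∈ centralInterval ν 1, ∀ y ∈ centralInterval ν 1, ¬ x < y := by
    intro x hx y hy hxy
    rw [mem_centralInterval_iff] at hx hy
    have := hy.2 x hxy
    linarith [hx.1]
  intro x hx y hy
  exact le_antisymm (not_lt.1 (key y hy x hx)) (not_lt.1 (key x hx y hy))

/-- The central interval is equivariant under increasing affine maps. -/
theorem mem_centralInterval_map_affine {ν : Measure ℝ} [IsProbabilityMeasure ν] {s c : ℝ}
    (hs : 0 < s) (α y : ℝ) :
    s * y + c ∈ centralInterval (ν.map fun z => s * z + c) α ↔ y ∈ centralInterval ν α := by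
  have hm : Measurable fun z : ℝ => s * z + c := by fun_prop
  have : IsProbabilityMeasure (ν.map fun z => s * z + c) :=
    Measure.isProbabilityMeasure_map hm.aemeasurable
  have hcdf : ∀ x, cdf (ν.map fun z => s * z + c) (s * x + c) = cdf ν x := by
    intro x
    rw [cdf_eq_real, cdf_eq_real, map_measureReal_apply hm measurableSet_Iic]
    congr 1
    ext z
    simp [hs]
  rw [mem_centralInterval_iff, mem_centralInterval_iff, hcdf]
  refine and_congr_right fun _ => ⟨fun h x hx => ?_, fun h x hx => ?_⟩
  · rw [← hcdf]
    exact h _ (by nlinarith)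
  · have hx' : x = s * ((x - c) / s) + c := by field_simp; ring
    rw [hx', hcdf]
    refine h _ ?_
    rw [div_lt_iff₀ hs]
    linarith

/-- The set is a lower ray, open or closed. Inner regularity avoids the distinction: a compact
subset contains its maximum, where the distribution function is below `p`. -/
theorem measure_cdf_lt_le (ν : Measure ℝ) [IsProbabilityMeasure ν] (p : ℝ) :
    ν {y | cdf ν y < p} ≤ ENNReal.ofReal p := by
  have hmeas : MeasurableSet {y | cdf ν y < p} :=
    (monotone_cdf ν).measurable measurableSet_Iio
  rw [hmeas.measure_eq_iSup_isCompact]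
  refine iSup_le fun K => iSup_le fun hK => iSup_le fun hc => ?_
  rcases K.eq_empty_or_nonempty with rfl | hne
  · simp
  · have h := hK (hc.sSup_mem hne)
    calc ν K ≤ ν (Set.Iic (sSup K)) := measure_mono fun x hx => le_csSup hc.bddAbove hx
      _ = ENNReal.ofReal (cdf ν (sSup K)) := (ofReal_cdf ν _).symm
      _ ≤ ENNReal.ofReal p := ENNReal.ofReal_le_ofReal (le_of_lt h)

theorem measure_exists_lt_cdf_le (ν : Measure ℝ) [IsProbabilityMeasure ν] (q : ℝ) :
    ν {y | ∃ x < y, q ≤ cdf ν x} ≤ ENNReal.ofReal (1 - q) := by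
  have hup : {y | ∃ x < y, q ≤ cdf ν x}.OrdConnected :=
    ⟨fun _ ⟨w, hw, hq⟩ _ _ _ hz => ⟨w, hw.trans_le hz.1, hq⟩⟩
  rw [hup.measurableSet.measure_eq_iSup_isCompact]
  refine iSup_le fun K => iSup_le fun hK => iSup_le fun hc => ?_
  rcases K.eq_empty_or_nonempty with rfl | hne
  · simp
  · obtain ⟨x, hx, hq⟩ := hK (hc.sInf_mem hne)
    have hsub : K ⊆ (Set.Iic x)ᶜ := fun z hz h =>
      absurd (h : z ≤ x) (not_le.2 (hx.trans_le (csInf_le hc.bddBelow hz)))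
    calc ν K ≤ ν (Set.Iic x)ᶜ := measure_mono hsub
      _ = ENNReal.ofReal (1 - cdf ν x) := by
        rw [prob_compl_eq_one_sub measurableSet_Iic, ← ofReal_cdf,
          ENNReal.ofReal_sub _ (cdf_nonneg ν x), ENNReal.ofReal_one]
      _ ≤ ENNReal.ofReal (1 - q) := ENNReal.ofReal_le_ofReal (by linarith)

theorem le_measure_centralInterval (ν : Measure ℝ) [IsProbabilityMeasure ν] {α : ℝ}
    (hα : 0 ≤ α) : ENNReal.ofReal (1 - α) ≤ ν (centralInterval ν α) := by
  have hcompl : (centralInterval ν α)ᶜ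
      ⊆ {y | cdf ν y < α / 2} ∪ {y | ∃ x < y, 1 - α / 2 ≤ cdf ν x} := by
    intro y hy
    rw [Set.mem_compl_iff, mem_centralInterval_iff, not_and_or] at hy
    rcases hy with h | h
    · exact Or.inl (not_le.1 h)
    · push Not at h
      exact Or.inr h
  have h1 : ν (centralInterval ν α)ᶜ ≤ ENNReal.ofReal α := by
    calc ν (centralInterval ν α)ᶜ ≤ _ := measure_mono hcompl
      _ ≤ _ := measure_union_le _ _
      _ ≤ ENNReal.ofReal (α / 2) + ENNReal.ofReal (1 - (1 - α / 2)) :=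
        add_le_add (measure_cdf_lt_le ν _) (measure_exists_lt_cdf_le ν _)
      _ = ENNReal.ofReal α := by
        rw [← ENNReal.ofReal_add (by linarith) (by linarith)]
        congr 1
        ring
  have h2 := prob_add_prob_compl (μ := ν) (measurableSet_centralInterval ν α)
  rw [ENNReal.ofReal_sub _ hα, ENNReal.ofReal_one, tsub_le_iff_right, ← h2]
  gcongr

/-- By symmetry `F(0) ≥ 1/2`, and `F(x) ≤ 1/2` for `x < 0`; the strict bound by `1 - α / 2` needs `α
< 1`. -/
theorem zero_mem_centralInterval {ν : Measure ℝ} [IsProbabilityMeasure ν]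
    (hν : ν.map (fun x => -x) = ν) {α : ℝ} (hα : α < 1) : (0 : ℝ) ∈ centralInterval ν α := by
  have hneg : ∀ x, ν.real (Set.Ici (-x)) = cdf ν x := by
    intro x
    rw [cdf_eq_real]
    conv_rhs => rw [← hν, map_measureReal_apply measurable_neg measurableSet_Iic]
    congr 1
    ext z
    simp
  rw [mem_centralInterval_iff]
  constructor
  · have h : (1 : ℝ) ≤ ν.real (Set.Iic 0) + ν.real (Set.Ici (-0)) := by
      rw [neg_zero, ← probReal_univ (μ := ν), ← Set.Iic_union_Ici (a := (0 : ℝ))]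
      exact measureReal_union_le _ _
    rw [hneg, ← cdf_eq_real] at h
    linarith
  · intro x hx
    have h : ν.real (Set.Iic x) + ν.real (Set.Ici (-x)) ≤ 1 := by
      rw [← measureReal_union _ measurableSet_Ici]
      · exact measureReal_le_one
      · rw [Set.disjoint_left]
        intro z hz hz'
        simp only [Set.mem_Iic, Set.mem_Ici] at hz hz'
        linarith
    rw [hneg, ← cdf_eq_real] at h
    linarith

/-! ### Spherical laws and conditioning on one coordinate -/

theorem map_cond_preimage {α β : Type*} [MeasurableSpace α] [MeasurableSpace β] {μ : Measure α}
    {f : α → β} (hf : Measurable f) {s : Set β} (hs : MeasurableSet s) :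
    (μ[|f ⁻¹' s]).map f = (μ.map f)[|s] := by
  unfold ProbabilityTheory.cond
  rw [Measure.map_smul, Measure.restrict_map hf hs, Measure.map_apply hf hs]

/-- A measure invariant under all linear isometries. -/
def IsSpherical {d : ℕ} (ρ : Measure (EuclideanSpace ℝ (Fin d))) : Prop :=
  ∀ U : EuclideanSpace ℝ (Fin d) ≃ₗᵢ[ℝ] EuclideanSpace ℝ (Fin d), ρ.map U = ρ

/-- A finite measure whose characteristic function depends on the norm only is spherical. -/
theorem isSpherical_of_charFun {d : ℕ} {ρ : Measure (EuclideanSpace ℝ (Fin d))}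
    [IsFiniteMeasure ρ] {ψ : ℝ → ℂ} (h : ∀ t, charFun ρ t = ψ ‖t‖) : IsSpherical ρ := by
  intro U
  apply Measure.ext_of_charFun
  ext t
  have hinner : ∀ x, inner ℝ (U x) t = inner ℝ x (U.symm t) := by
    intro x
    rw [← U.inner_map_map x (U.symm t), U.apply_symm_apply]
  have : charFun (ρ.map U) t = charFun ρ (U.symm t) := by
    rw [charFun_apply, charFun_apply,
      integral_map U.continuous.measurable.aemeasurable
        (by fun_prop : Continuous _).aestronglyMeasurable]
    simp_rw [hinner]
  rw [this, h, h, LinearIsometryEquiv.norm_map]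

/-- The linear isometry permuting the coordinates. -/
noncomputable def permIsometry {d : ℕ} (σ : Equiv.Perm (Fin d)) :
    EuclideanSpace ℝ (Fin d) ≃ₗᵢ[ℝ] EuclideanSpace ℝ (Fin d) :=
  LinearIsometryEquiv.piLpCongrLeft 2 ℝ ℝ σ

@[simp] theorem permIsometry_apply {d : ℕ} (σ : Equiv.Perm (Fin d))
    (z : EuclideanSpace ℝ (Fin d)) (k : Fin d) : permIsometry σ z k = z (σ.symm k) := rfl

/-- The linear isometry changing the sign of the `j`-th coordinate. -/
noncomputable def flipIsometry {d : ℕ} (j : Fin d) :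
    EuclideanSpace ℝ (Fin d) ≃ₗᵢ[ℝ] EuclideanSpace ℝ (Fin d) :=
  LinearIsometryEquiv.piLpCongrRight 2 fun k =>
    if k = j then LinearIsometryEquiv.neg ℝ else LinearIsometryEquiv.refl ℝ ℝ

@[simp] theorem flipIsometry_apply_self {d : ℕ} (j : Fin d) (z : EuclideanSpace ℝ (Fin d)) :
    flipIsometry j z j = -z j := by
  simp [flipIsometry]

theorem flipIsometry_apply_of_ne {d : ℕ} {j k : Fin d} (h : k ≠ j)
    (z : EuclideanSpace ℝ (Fin d)) : flipIsometry j z k = z k := by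
  simp [flipIsometry, h]

namespace IsSpherical

variable {d : ℕ} {ρ : Measure (EuclideanSpace ℝ (Fin d))}

theorem integral_comp (hρ : IsSpherical ρ)
    (U : EuclideanSpace ℝ (Fin d) ≃ₗᵢ[ℝ] EuclideanSpace ℝ (Fin d))
    (f : EuclideanSpace ℝ (Fin d) → ℝ) : ∫ z, f (U z) ∂ρ = ∫ z, f z ∂ρ := by
  conv_rhs => rw [← hρ U]
  exact (integral_map_equiv U.toHomeomorph.toMeasurableEquiv f).symm

theorem integrable_comp (hρ : IsSpherical ρ)
    (U : EuclideanSpace ℝ (Fin d) ≃ₗᵢ[ℝ] EuclideanSpace ℝ (Fin d))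
    {f : EuclideanSpace ℝ (Fin d) → ℝ} (hf : Integrable f ρ) :
    Integrable (fun z => f (U z)) ρ := by
  rw [← hρ U] at hf
  exact hf.comp_measurable U.continuous.measurable

theorem map_cond (hρ : IsSpherical ρ)
    (U : EuclideanSpace ℝ (Fin d) ≃ₗᵢ[ℝ] EuclideanSpace ℝ (Fin d))
    {B : Set (EuclideanSpace ℝ (Fin d))} (hB : MeasurableSet B) :
    (ρ[|U ⁻¹' B]).map U = ρ[|B] := by
  rw [map_cond_preimage U.continuous.measurable hB, hρ U]

theorem map_coord (hρ : IsSpherical ρ) (i j : Fin d) :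
    ρ.map (fun z => z i) = ρ.map (fun z => z j) := by
  conv_lhs => rw [← hρ (permIsometry (Equiv.swap i j)),
    Measure.map_map (by fun_prop) (LinearIsometryEquiv.continuous _).measurable]
  congr 1
  ext z
  simp

theorem map_coord_neg (hρ : IsSpherical ρ) (i : Fin d) :
    (ρ.map (fun z => z i)).map (fun x => -x) = ρ.map (fun z => z i) := by
  conv_rhs => rw [← hρ (flipIsometry i),
    Measure.map_map (by fun_prop) (LinearIsometryEquiv.continuous _).measurable]
  rw [Measure.map_map (by fun_prop) (by fun_prop)]
  congr 1
  ext z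
  simp

variable {T : Set ℝ}

/-- Conditional variances are equivariant under exchanging two coordinates. -/
theorem variance_cond_swap (hρ : IsSpherical ρ) (hT : MeasurableSet T) (i j k : Fin d) :
    Var[fun z => z k; ρ[|{z | z j ∈ T}]]
      = Var[fun z => z (Equiv.swap i j k); ρ[|{z | z i ∈ T}]] := by
  have hm : Measurable fun z : EuclideanSpace ℝ (Fin d) => z j := by fun_prop
  have hB : MeasurableSet {z : EuclideanSpace ℝ (Fin d) | z j ∈ T} := hm hT
  rw [← hρ.map_cond (permIsometry (Equiv.swap i j)) hB,
    variance_map (by fun_prop) (LinearIsometryEquiv.continuous _).measurable.aemeasurable]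
  congr 1
  · congr 1
    ext z
    simp

/-- Flipping the sign of coordinate `j` leaves the conditioning event on coordinate `i` unchanged.
-/
theorem integral_cond_eq_zero (hρ : IsSpherical ρ) (hT : MeasurableSet T) {i j : Fin d}
    (hij : i ≠ j) : ∫ z, z j ∂(ρ[|{z | z i ∈ T}]) = 0 := by
  have hm : Measurable fun z : EuclideanSpace ℝ (Fin d) => z i := by fun_prop
  have hB : MeasurableSet {z : EuclideanSpace ℝ (Fin d) | z i ∈ T} := hm hT
  have h : ∫ z, z j ∂(ρ[|{z | z i ∈ T}]) = ∫ z, -z j ∂(ρ[|{z | z i ∈ T}]) := by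
    conv_lhs => rw [← hρ.map_cond (flipIsometry j) hB]
    rw [integral_map (LinearIsometryEquiv.continuous _).measurable.aemeasurable
      (by fun_prop : Measurable _).aestronglyMeasurable]
    have : flipIsometry j ⁻¹' {z : EuclideanSpace ℝ (Fin d) | z i ∈ T} = {z | z i ∈ T} := by
      ext z
      simp [flipIsometry_apply_of_ne hij]
    simp only [flipIsometry_apply_self]
    rw [this]
  rw [integral_neg] at h
  linarith

/-- Conditioning one coordinate of a spherical law on an interval around the origin makes its
second moment at most that of the other coordinates. -/
theorem setIntegral_sq_le (hρ : IsSpherical ρ) (hL : ∀ k, MemLp (fun z => z k) 2 ρ)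
    (hT : T.OrdConnected) (h0 : (0 : ℝ) ∈ T) {i j : Fin d} (hij : i ≠ j) :
    ∫ z in {z | z i ∈ T}, z i ^ 2 ∂ρ ≤ ∫ z in {z | z i ∈ T}, z j ^ 2 ∂ρ := by
  have hm : Measurable fun z : EuclideanSpace ℝ (Fin d) => z i := by fun_prop
  have hB : MeasurableSet {z : EuclideanSpace ℝ (Fin d) | z i ∈ T} := hm hT.measurableSet
  have hI : ∀ k, Integrable (fun z : EuclideanSpace ℝ (Fin d) => z k ^ 2) ρ :=
    fun k => (hL k).integrable_sq
  set g : ℝ → ℝ := T.indicator fun _ => 1 with hg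
  set f : EuclideanSpace ℝ (Fin d) → ℝ := fun z => (z i ^ 2 - z j ^ 2) * g (z i) with hf
  have hfind : f = {z | z i ∈ T}.indicator fun z => z i ^ 2 - z j ^ 2 := by
    ext z
    by_cases hz : z i ∈ T <;> simp [hf, hg, hz]
  have hfI : Integrable f ρ := by
    rw [hfind]
    exact ((hI i).sub (hI j)).indicator hB
  -- `T` need not be symmetric, since both quantiles are infima; only `0 ∈ T` and convexity are
  -- available. They still make the number of signs with `±x ∈ T` nonincreasing in `|x|`.
  have hmono : ∀ x y : ℝ, x ^ 2 ≤ y ^ 2 → g y + g (-y) ≤ g x + g (-x) := by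
    intro x y hxy
    have habs := sq_le_sq.1 hxy
    have hx := abs_le.1 habs
    have hy := abs_nonneg y
    have key : ∀ w, |w| = |y| → w ∈ T → x ∈ T ∨ -x ∈ T := by
      intro w hw hwT
      rcases le_total 0 w with h | h
      · rw [abs_of_nonneg h] at hw
        rcases le_total 0 x with h' | h'
        · exact Or.inl (hT.out h0 hwT ⟨h', by linarith⟩)
        · exact Or.inr (hT.out h0 hwT ⟨by linarith, by linarith⟩)
      · rw [abs_of_nonpos h] at hw
        rcases le_total 0 x with h' | h'
        · exact Or.inr (hT.out hwT h0 ⟨by linarith, by linarith⟩)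
        · exact Or.inl (hT.out hwT h0 ⟨by linarith, by linarith⟩)
    have hboth : y ∈ T → -y ∈ T → x ∈ T ∧ -x ∈ T := by
      intro h1 h2
      rcases le_total 0 y with h | h
      · rw [abs_of_nonneg h] at hx
        exact ⟨hT.out h2 h1 ⟨by linarith, by linarith⟩, hT.out h2 h1 ⟨by linarith, by linarith⟩⟩
      · rw [abs_of_nonpos h] at hx
        exact ⟨hT.out h1 h2 ⟨by linarith, by linarith⟩, hT.out h1 h2 ⟨by linarith, by linarith⟩⟩
    have k1 := key y rfl
    have k2 := key (-y) (abs_neg y)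
    by_cases a : y ∈ T <;> by_cases b : -y ∈ T <;> by_cases c : x ∈ T <;>
      by_cases e : -x ∈ T <;> simp_all
  set Fi := flipIsometry i
  set W := permIsometry (Equiv.swap i j)
  have hfF : ∀ z, f (Fi z) = (z i ^ 2 - z j ^ 2) * g (-z i) := by
    intro z
    simp [hf, Fi, flipIsometry_apply_of_ne hij.symm]
  have hfFI := hρ.integrable_comp Fi hfI
  set s : EuclideanSpace ℝ (Fin d) → ℝ := fun z => f z + f (Fi z) with hs
  have hsI : Integrable s ρ := hfI.add hfFI
  have h1 : ∫ z, s z ∂ρ = 2 * ∫ z, f z ∂ρ := by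
    rw [hs, integral_add hfI hfFI, hρ.integral_comp Fi f]
    ring
  have h2 : ∫ z, (s z + s (W z)) ∂ρ = 2 * ∫ z, s z ∂ρ := by
    rw [integral_add hsI (hρ.integrable_comp W hsI), hρ.integral_comp W s]
    ring
  have h3 : ∫ z, (s z + s (W z)) ∂ρ ≤ 0 := by
    refine integral_nonpos fun z => ?_
    have hWi : W z i = z j := by simp [W]
    have hWj : W z j = z i := by simp [W]
    simp only [hs, hfF, Pi.zero_apply]
    simp only [hf, hWi, hWj]
    -- With `G x = g x + g (-x)`, the integrand is `(z i ^ 2 - z j ^ 2) * (G (z i) - G (z j))`,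
    -- whose factors have opposite signs.
    rcases le_total (z i ^ 2) (z j ^ 2) with h | h
    · nlinarith [hmono _ _ h]
    · nlinarith [hmono _ _ h]
  have h4 : ∫ z, f z ∂ρ
      = ∫ z in {z | z i ∈ T}, z i ^ 2 ∂ρ - ∫ z in {z | z i ∈ T}, z j ^ 2 ∂ρ := by
    rw [hfind, integral_indicator hB, integral_sub (hI i).integrableOn (hI j).integrableOn]
  linarith

/-- The conditional mean of `z j` vanishes, so its variance is its second moment, while that of `z
i` is at most its second moment. The subsingleton alternative serves `α = 1`, where `T` may miss 0
but `z i` is conditionally constant. -/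
theorem variance_cond_le [IsProbabilityMeasure ρ] (hρ : IsSpherical ρ)
    (hL : ∀ k, MemLp (fun z => z k) 2 ρ) (hT : T.OrdConnected)
    (h0 : (0 : ℝ) ∈ T ∨ T.Subsingleton) {i j : Fin d} (hij : i ≠ j) :
    Var[fun z => z i; ρ[|{z | z i ∈ T}]] ≤ Var[fun z => z j; ρ[|{z | z i ∈ T}]] := by
  have hm : ∀ k, Measurable fun z : EuclideanSpace ℝ (Fin d) => z k := fun k => by fun_prop
  have hB : MeasurableSet {z : EuclideanSpace ℝ (Fin d) | z i ∈ T} := hm i hT.measurableSet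
  by_cases hne : ρ {z | z i ∈ T} = 0
  · rw [cond_eq_zero_of_meas_eq_zero hne]
    simp
  have := cond_isProbabilityMeasure hne
  rcases h0 with h0 | hsub
  · rw [variance_of_integral_eq_zero (hm j).aemeasurable
      (hρ.integral_cond_eq_zero hT.measurableSet hij)]
    refine (variance_le_expectation_sq (hm i).aestronglyMeasurable).trans ?_
    simp only [Pi.pow_apply, ProbabilityTheory.cond, integral_smul_measure]
    exact smul_le_smul_of_nonneg_left (hρ.setIntegral_sq_le hL hT h0 hij) ENNReal.toReal_nonneg
  · obtain ⟨w, hw⟩ := nonempty_of_measure_ne_zero hne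
    have hae : (fun z : EuclideanSpace ℝ (Fin d) => z i) =ᵐ[ρ[|{z | z i ∈ T}]] fun _ => w i := by
      filter_upwards [ae_cond_mem hB] with z hz using hsub hz hw
    rw [variance_congr hae]
    have hz : Var[fun _ : EuclideanSpace ℝ (Fin d) => w i; ρ[|{z | z i ∈ T}]] = 0 := by
      rw [variance_eq_integral (by fun_prop)]
      simp
    rw [hz]
    exact variance_nonneg _ _

end IsSpherical

/-! ### Standardization of an elliptical vector -/

variable {Ω : Type*} {d : ℕ}
  {X : Ω → EuclideanSpace ℝ (Fin d)} {m : EuclideanSpace ℝ (Fin d)}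
  {S : Matrix (Fin d) (Fin d) ℝ} {lam : Fin d → ℝ} {v : Fin d → EuclideanSpace ℝ (Fin d)}

theorem rotate_apply (v : Fin d → EuclideanSpace ℝ (Fin d)) (X : Ω → EuclideanSpace ℝ (Fin d))
    (ω : Ω) (k : Fin d) : rotate v X ω k = inner ℝ (v k) (X ω) := by
  simp [rotate, columnMatrix, Matrix.mulVec, dotProduct, PiLp.inner_apply, mul_comm]

theorem eigenvalue_pos (hS : S.PosDef) (hv : Orthonormal ℝ v)
    (heig : ∀ i, S *ᵥ (v i).ofLp = lam i • (v i).ofLp) (i : Fin d) : 0 < lam i := by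
  have hne : (v i).ofLp ≠ 0 := fun h => hv.ne_zero i (by ext k; simp [h])
  have h := hS.dotProduct_mulVec_pos hne
  have h1 : star (v i).ofLp ⬝ᵥ (v i).ofLp = 1 := by
    rw [dotProduct_comm, ← EuclideanSpace.inner_eq_star_dotProduct, real_inner_self_eq_norm_sq,
      hv.1 i, one_pow]
  rwa [heig, dotProduct_smul, h1, smul_eq_mul, mul_one] at h

/-- The standardized rotated vector `Λ^(-1/2) Vᵀ (X - m)`. -/
noncomputable def standardize (lam : Fin d → ℝ) (v : Fin d → EuclideanSpace ℝ (Fin d))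
    (m : EuclideanSpace ℝ (Fin d)) (X : Ω → EuclideanSpace ℝ (Fin d)) :
    Ω → EuclideanSpace ℝ (Fin d) :=
  fun ω => WithLp.toLp 2 fun k => (√(lam k))⁻¹ * inner ℝ (v k) (X ω - m)

theorem rotate_eq_standardize (hlam : ∀ k, 0 < lam k) (v : Fin d → EuclideanSpace ℝ (Fin d))
    (m : EuclideanSpace ℝ (Fin d)) (X : Ω → EuclideanSpace ℝ (Fin d)) (ω : Ω) (k : Fin d) :
    rotate v X ω k = √(lam k) * standardize lam v m X ω k + inner ℝ (v k) m := by
  have h := (Real.sqrt_pos.2 (hlam k)).ne'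
  simp only [rotate_apply, standardize, inner_sub_right]
  rw [mul_inv_cancel_left₀ h]
  ring

variable [MeasurableSpace Ω] {P : Measure Ω}

theorem measurable_standardize (hX : Measurable X) : Measurable (standardize lam v m X) := by
  have : Continuous fun x : EuclideanSpace ℝ (Fin d) =>
      (WithLp.toLp 2 fun k => (√(lam k))⁻¹ * inner ℝ (v k) (x - m) :
        EuclideanSpace ℝ (Fin d)) := by fun_prop
  exact this.measurable.comp hX

theorem memLp_standardize [IsFiniteMeasure P] (hX : MemLp X 2 P) (k : Fin d) :
    MemLp (fun ω => standardize lam v m X ω k) 2 P :=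
  ((hX.sub (memLp_const m)).const_inner (v k)).const_mul _

theorem IsElliptical.isSpherical [IsProbabilityMeasure P] (hX : IsElliptical X P m S)
    (hv : Orthonormal ℝ v) (heig : ∀ i, S *ᵥ (v i).ofLp = lam i • (v i).ofLp) :
    IsSpherical (P.map (standardize lam v m X)) := by
  have hlam := eigenvalue_pos hX.posDef hv heig
  have hZ := measurable_standardize (lam := lam) (v := v) (m := m) hX.measurable
  obtain ⟨φ, hφ⟩ := hX.charFun_eq
  have := Measure.isProbabilityMeasure_map (μ := P) hZ.aemeasurable
  refine isSpherical_of_charFun (ψ := fun r => φ (r ^ 2)) fun t => ?_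
  -- `w = V Λ^(-1/2) t` is the adjoint image of `t`: `⟨Z, t⟩ = ⟨X - m, w⟩` and `wᵀ S w = ‖t‖ ^ 2`.
  set w : EuclideanSpace ℝ (Fin d) := ∑ k, ((√(lam k))⁻¹ * t k) • v k with hw
  have hquad : w.ofLp ⬝ᵥ (S *ᵥ w.ofLp) = ‖t‖ ^ 2 := by
    have hSw : S *ᵥ w.ofLp = (∑ k, (√(lam k) * t k) • v k : EuclideanSpace ℝ (Fin d)).ofLp := by
      simp only [hw, WithLp.ofLp_sum, WithLp.ofLp_smul, Matrix.mulVec_sum, Matrix.mulVec_smul,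
        heig, smul_smul]
      refine Finset.sum_congr rfl fun k _ => ?_
      congr 1
      have h := (Real.sqrt_pos.2 (hlam k)).ne'
      nth_rewrite 2 [← Real.mul_self_sqrt (hlam k).le]
      field_simp
    rw [hSw, dotProduct_comm]
    have h2 : ∀ x y : EuclideanSpace ℝ (Fin d), y.ofLp ⬝ᵥ x.ofLp = inner ℝ x y := fun x y => by
      rw [EuclideanSpace.inner_eq_star_dotProduct, star_trivial]
    rw [h2, hw, hv.inner_sum, EuclideanSpace.real_norm_sq_eq]
    refine Finset.sum_congr rfl fun k _ => ?_
    have h := (Real.sqrt_pos.2 (hlam k)).ne'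
    simp only [conj_trivial]
    field_simp
  have hinner : ∀ ω, inner ℝ (standardize lam v m X ω) t = inner ℝ (X ω) w - inner ℝ w m := by
    intro ω
    rw [real_inner_comm m w, ← inner_sub_left, hw, inner_sum, PiLp.inner_apply]
    refine Finset.sum_congr rfl fun k _ => ?_
    simp only [standardize, inner_smul_right, real_inner_comm (X ω - m) (v k)]
    simp
    ring
  have h1 := hφ w
  rw [hquad, charFun_apply, integral_map hX.measurable.aemeasurable
    (by fun_prop : Continuous _).aestronglyMeasurable] at h1
  rw [charFun_apply, integral_map hZ.aemeasurable
    (by fun_prop : Continuous _).aestronglyMeasurable]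
  simp_rw [hinner, Complex.ofReal_sub, sub_mul, Complex.exp_sub, div_eq_mul_inv]
  rw [integral_mul_const, h1, mul_comm Complex.I]
  field_simp [Complex.exp_ne_zero]

theorem peelEvent_rotate [IsProbabilityMeasure P] (hX : Measurable X) (hlam : ∀ k, 0 < lam k)
    (α : ℝ) (i : Fin d) :
    peelEvent (rotate v X) P α i = standardize lam v m X ⁻¹'
      {z | z i ∈ centralInterval ((P.map (standardize lam v m X)).map fun z => z i) α} := by
  have hZ := measurable_standardize (lam := lam) (v := v) (m := m) hX
  have := Measure.isProbabilityMeasure_map (μ := P) hZ.aemeasurable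
  have hc : Measurable fun z : EuclideanSpace ℝ (Fin d) => z i := by fun_prop
  have := Measure.isProbabilityMeasure_map (μ := P.map (standardize lam v m X)) hc.aemeasurable
  have hlaw : (P.map fun ω => rotate v X ω i)
      = ((P.map (standardize lam v m X)).map fun z => z i).map
          fun y => √(lam i) * y + inner ℝ (v i) m := by
    rw [Measure.map_map (by fun_prop) hc, Measure.map_map (by fun_prop) hZ]
    congr 1
    ext ω
    exact rotate_eq_standardize hlam v m X ω i
  ext ω
  simp only [peelEvent, Set.mem_ofPred_eq, Set.mem_preimage]
  rw [hlaw, rotate_eq_standardize hlam v m X ω i]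
  exact mem_centralInterval_map_affine (Real.sqrt_pos.2 (hlam i)) _ _

theorem le_measure_peelEvent [IsProbabilityMeasure P] {Y : Ω → EuclideanSpace ℝ (Fin d)}
    (hY : Measurable Y) {α : ℝ} (hα : 0 ≤ α) (i : Fin d) :
    ENNReal.ofReal (1 - α) ≤ P (peelEvent Y P α i) := by
  have hYi : Measurable fun ω => Y ω i := by fun_prop
  have := Measure.isProbabilityMeasure_map (μ := P) hYi.aemeasurable
  have h := le_measure_centralInterval (P.map fun ω => Y ω i) hα
  rwa [Measure.map_apply hYi (measurableSet_centralInterval _ _)] at h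

theorem measurable_rotate (hX : Measurable X) : Measurable (rotate v X) := by
  have : Continuous fun x : EuclideanSpace ℝ (Fin d) =>
      (WithLp.toLp 2 ((columnMatrix v)ᵀ *ᵥ x.ofLp) : EuclideanSpace ℝ (Fin d)) := by fun_prop
  exact this.measurable.comp hX

theorem preservedTotalVariance_rotate [IsProbabilityMeasure P] (hX : Measurable X)
    (hlam : ∀ k, 0 < lam k) (α : ℝ) (i : Fin d) :
    preservedTotalVariance (rotate v X) P α i
      = ∑ k, lam k * Var[fun z => z k; (P.map (standardize lam v m X))[|
          {z | z i ∈ centralInterval ((P.map (standardize lam v m X)).map fun z => z i) α}]] := by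
  have hZ := measurable_standardize (lam := lam) (v := v) (m := m) hX
  have hc : ∀ k, Measurable fun z : EuclideanSpace ℝ (Fin d) => z k := fun k => by fun_prop
  have hB : MeasurableSet {z : EuclideanSpace ℝ (Fin d) |
      z i ∈ centralInterval ((P.map (standardize lam v m X)).map fun z => z i) α} :=
    hc i (measurableSet_centralInterval _ _)
  unfold preservedTotalVariance
  rw [peelEvent_rotate (m := m) hX hlam, ← map_cond_preimage hZ hB]
  set A := standardize lam v m X ⁻¹' _
  refine Finset.sum_congr rfl fun k _ => ?_
  have hYk : Measurable fun ω => rotate v X ω k := (hc k).comp (measurable_rotate hX)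
  simp only [Matrix.diag_apply, covMatrix, Matrix.of_apply]
  rw [covariance_self hYk.aemeasurable, variance_map (hc k).aemeasurable hZ.aemeasurable]
  -- On a null event the conditional measure is 0 and both variances vanish; otherwise it is a
  -- probability measure, as shift invariance of the variance requires.
  by_cases hA : P A = 0
  · simp [cond_eq_zero_of_meas_eq_zero hA]
  have := cond_isProbabilityMeasure hA
  simp_rw [rotate_eq_standardize hlam v m X]
  rw [variance_add_const (by fun_prop), variance_const_mul, Real.sq_sqrt (hlam k).le]
  rfl

/-! ### Comparison of the preserved variances -/

/-- Only the terms `i` and `j` differ, and the gap is `(a j - a i) * (w j - w i)`. -/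
theorem sum_mul_le_sum_mul_swap {ι : Type*} [Fintype ι] [DecidableEq ι] {a w : ι → ℝ} {i j : ι}
    (ha : a i ≤ a j) (hw : w i ≤ w j) :
    ∑ k, a k * w (Equiv.swap i j k) ≤ ∑ k, a k * w k := by
  rcases eq_or_ne i j with rfl | hij
  · simp
  rw [← sub_nonneg, ← Finset.sum_sub_distrib,
    Fintype.sum_eq_add i j hij fun k hk => by simp [Equiv.swap_apply_of_ne_of_ne hk.1 hk.2]]
  simp only [Equiv.swap_apply_left, Equiv.swap_apply_right]
  nlinarith [mul_nonneg (sub_nonneg.2 ha) (sub_nonneg.2 hw)]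

theorem IsElliptical.preservedTotalVariance_le [IsProbabilityMeasure P]
    (hX : IsElliptical X P m S) (hv : Orthonormal ℝ v)
    (heig : ∀ i, S *ᵥ (v i).ofLp = lam i • (v i).ofLp) {α : ℝ} (hα : α ≤ 1) {i j : Fin d}
    (hij : lam i ≤ lam j) :
    preservedTotalVariance (rotate v X) P α j ≤ preservedTotalVariance (rotate v X) P α i := by
  rcases eq_or_ne i j with rfl | hne
  · exact le_rfl
  have hlam := eigenvalue_pos hX.posDef hv heig
  have hZ := measurable_standardize (lam := lam) (v := v) (m := m) hX.measurable
  have := Measure.isProbabilityMeasure_map (μ := P) hZ.aemeasurable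
  have hρ := hX.isSpherical hv heig
  -- `map_coord` makes both sides condition on the same interval.
  rw [preservedTotalVariance_rotate (m := m) hX.measurable hlam,
    preservedTotalVariance_rotate (m := m) hX.measurable hlam, hρ.map_coord j i]
  have hc : ∀ k, Measurable fun z : EuclideanSpace ℝ (Fin d) => z k := fun k => by fun_prop
  have hL : ∀ k, MemLp (fun z => z k) 2 (P.map (standardize lam v m X)) := fun k =>
    (memLp_map_measure_iff (hc k).aestronglyMeasurable hZ.aemeasurable).2
      (memLp_standardize hX.memLp k)
  set ρ := P.map (standardize lam v m X)
  have := Measure.isProbabilityMeasure_map (μ := ρ) (hc i).aemeasurable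
  have h0 : (0 : ℝ) ∈ centralInterval (ρ.map fun z => z i) α ∨
      (centralInterval (ρ.map fun z => z i) α).Subsingleton := by
    rcases hα.lt_or_eq with h | rfl
    · exact Or.inl (zero_mem_centralInterval (hρ.map_coord_neg i) h)
    · exact Or.inr (subsingleton_centralInterval_one _)
  simp_rw [hρ.variance_cond_swap (measurableSet_centralInterval _ _) i j]
  exact sum_mul_le_sum_mul_swap
    (w := fun k => Var[fun z => z k; ρ[|{z | z i ∈ centralInterval (ρ.map fun z => z i) α}]]) hij
    (hρ.variance_cond_le hL (ordConnected_centralInterval _ _) h0 hne)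

end Peeling

theorem mainTheorem5 {Ω : Type*} [MeasurableSpace Ω] (P : Measure Ω) [IsProbabilityMeasure P]
    (d : ℕ) (hd : 0 < d)
    (X : Ω → EuclideanSpace ℝ (Fin d)) (m : EuclideanSpace ℝ (Fin d))
    (S : Matrix (Fin d) (Fin d) ℝ) (hX : Peeling.IsElliptical X P m S)
    (lam : Fin d → ℝ) (hlam : Antitone lam)
    (v : Fin d → EuclideanSpace ℝ (Fin d)) (hv : Orthonormal ℝ v)
    (heig : ∀ i, S *ᵥ (v i).ofLp = lam i • (v i).ofLp)
    (α : ℝ) (hα : α ∈ Set.Icc (0 : ℝ) 1) :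
    (∀ i, ENNReal.ofReal (1 - α) ≤ P (Peeling.peelEvent (Peeling.rotate v X) P α i)) ∧
    (∀ i j, lam i ≤ lam j →
      Peeling.preservedTotalVariance (Peeling.rotate v X) P α j
        ≤ Peeling.preservedTotalVariance (Peeling.rotate v X) P α i) ∧
    (∀ i, Peeling.preservedTotalVariance (Peeling.rotate v X) P α i
        ≤ Peeling.preservedTotalVariance (Peeling.rotate v X) P α ⟨d - 1, by omega⟩) ∧
    (∀ i, Peeling.preservedTotalVariance (Peeling.rotate v X) P α ⟨0, hd⟩
        ≤ Peeling.preservedTotalVariance (Peeling.rotate v X) P α i) := by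
  refine ⟨fun i => Peeling.le_measure_peelEvent (Peeling.measurable_rotate hX.measurable) hα.1 i,
    fun i j hij => hX.preservedTotalVariance_le hv heig hα.2 hij,
    fun i => hX.preservedTotalVariance_le hv heig hα.2 (hlam ?_),
    fun i => hX.preservedTotalVariance_le hv heig hα.2 (hlam ?_)⟩
  · exact Fin.mk_le_mk.2 (by omega)
  · exact Fin.mk_le_mk.2 (Nat.zero_le _)
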